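/- Let $\mathbb{B}$ be a separable real Banach space and let $B=\{B(t)\}_{t\ge 0}$ be a continuous Brownian motion in $\mathbb{B}$; that is, $B$ is a $\mathbb{B}$-valued process with almost surely continuous paths, $B(0)=0$ almost surely, and independent increments, and there is a centered Gaussian Borel probability measure $\mu$ on $\mathbb{B}$ such that, for all $0\le s\le t$, the increment $B(t)-B(s)$ is distributed as $\sqrt{t-s}\,Z$, where $Z$ has law $\mu$. Let $\mathcal{N}$ be a seminorm on $\mathbb{B}$ that is continuous with respect to the topology of $\mathbb{B}$. Then for all $T,\lambda>0$, $$\mathrm{P}\Big\{\sup_{t\in[0,T]}\mathcal{N}(B(t))\ge\lambda\Big\}\le 2\,\mathrm{P}\big\{\mathcal{N}(B(T))\ge\lambda\big\}.$$ -/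

import Mathlib

open MeasureTheory ProbabilityTheory
open scoped NNReal

/-- A (continuous) Brownian motion in a real Banach space `E`: the process starts at `0`, has
independent increments, almost surely continuous paths, and there is a centered Gaussian Borel
measure `μ` on `E` (the law of `B 1`) such that, for `s ≤ t`, the increment `B t - B s` has the law
of `√(t - s) • Z`, where `Z` has law `μ`. (`HasLaw` includes a.e.-measurability.) -/
structure IsContinuousBrownianMotion {Ω E : Type*} [MeasurableSpace Ω]
    [NormedAddCommGroup E] [NormedSpace ℝ E] [MeasurableSpace E]
    (B : ℝ≥0 → Ω → E) (P : Measure Ω) : Prop where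
  start_zero : ∀ᵐ ω ∂P, B 0 ω = 0
  indep_increments : HasIndepIncrements B P
  gaussian_increments : ∃ μ : Measure E, IsGaussian μ ∧
    (∀ L : StrongDual ℝ E, ∫ x, L x ∂μ = 0) ∧
    ∀ s t : ℝ≥0, s ≤ t →
      HasLaw (fun ω => B t ω - B s ω) (μ.map (fun x => √((t : ℝ) - s) • x)) P
  continuous_paths : ∀ᵐ ω ∂P, Continuous (fun t => B t ω)

/-! The proof is Lévy's reflection argument. Increments along a finite grid are independent and
symmetric, so flipping the signs of all those after the first passage above `a`, at index `k`,
preserves their joint law. The original and reflected endpoints have midpoint `S_k`, so one of them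
also exceeds `a` in seminorm; both cases are equally likely, whence the factor 2
(`levy_maximal_pi`). Nested dyadic grids and path continuity give the bound on `[0, T]` for strict
thresholds (`measure_exists_lt_le`); letting these increase to `lam` gives the closed one. -/

/-- The characteristic functional at `L` depends only on the mean and variance of `L`, and these
agree for `L` and `-L` when the means vanish. -/
lemma IsGaussian.isNegInvariant_of_centered {E : Type*} [NormedAddCommGroup E] [NormedSpace ℝ E]
    [CompleteSpace E] [SecondCountableTopology E] [MeasurableSpace E] [BorelSpace E]
    (μ : Measure E) [IsGaussian μ] (h0 : ∀ L : StrongDual ℝ E, ∫ x, L x ∂μ = 0) :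
    μ.IsNegInvariant := by
  refine ⟨?_⟩
  have : IsFiniteMeasure μ.neg := by unfold Measure.neg; infer_instance
  refine Measure.ext_of_charFunDual (E := E) ?_
  ext L
  have h1 : charFunDual μ.neg L = charFunDual μ (-L) := by
    rw [charFunDual_apply, charFunDual_apply, Measure.neg,
      integral_map (by fun_prop) (by fun_prop)]
    simp
  rw [h1, IsGaussian.charFunDual_eq, IsGaussian.charFunDual_eq, integral_complex_ofReal,
    integral_complex_ofReal, h0, h0]
  have h2 : Var[(-L : StrongDual ℝ E); μ] = Var[L; μ] := variance_neg
  rw [h2]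

lemma isNegInvariant_map_smul {E : Type*} [NormedAddCommGroup E] [NormedSpace ℝ E]
    [MeasurableSpace E] [BorelSpace E] (μ : Measure E) [μ.IsNegInvariant] (c : ℝ) :
    (μ.map (fun x ↦ c • x)).IsNegInvariant := by
  refine ⟨?_⟩
  conv_rhs => rw [← Measure.map_neg_eq_self μ]
  rw [Measure.neg, Measure.map_map (by fun_prop) (by fun_prop),
    Measure.map_map (by fun_prop) (by fun_prop)]
  congr 1
  ext x
  simp

section Levy

variable {E : Type*} [NormedAddCommGroup E]

/-- The sum of the first `k` coordinates of `x : Fin n → E`. -/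
def partialSum {n : ℕ} (k : ℕ) (x : Fin n → E) : E := ∑ i : Fin n, if (i : ℕ) < k then x i else 0

/-- Change the sign of all coordinates of `x` with index at least `k`. -/
def flipFrom {n : ℕ} (k : ℕ) (x : Fin n → E) (i : Fin n) : E := if (i : ℕ) < k then x i else -x i

lemma partialSum_flipFrom_of_le {n j k : ℕ} (hjk : j ≤ k) (x : Fin n → E) :
    partialSum j (flipFrom k x) = partialSum j x := by
  refine Finset.sum_congr rfl fun i _ ↦ ?_
  unfold flipFrom
  grind

lemma measurable_partialSum [MeasurableSpace E] [BorelSpace E]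
    [SecondCountableTopology E] {n : ℕ} (k : ℕ) :
    Measurable (partialSum k : (Fin n → E) → E) := by
  refine Finset.measurable_fun_sum _ fun i _ ↦ ?_
  by_cases h : (i : ℕ) < k
  · simpa [h] using measurable_pi_apply i
  · simp [h]

lemma measurePreserving_flipFrom [MeasurableSpace E] [BorelSpace E] {n : ℕ} (k : ℕ)
    (μ : Fin n → Measure E)
    [∀ i, IsProbabilityMeasure (μ i)] [∀ i, (μ i).IsNegInvariant] :
    MeasurePreserving (flipFrom k) (Measure.pi μ) (Measure.pi μ) := by
  refine measurePreserving_pi μ μ (f := fun i y ↦ if (i : ℕ) < k then y else -y) fun i ↦ ?_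
  by_cases h : (i : ℕ) < k
  · simp only [h, if_true]
    exact MeasurePreserving.id (μ i)
  · simpa [h] using Measure.measurePreserving_neg (μ i)

variable [NormedSpace ℝ E]

lemma partialSum_flipFrom {n k : ℕ} (x : Fin n → E) :
    partialSum n (flipFrom k x) + partialSum n x = (2 : ℝ) • partialSum k x := by
  simp only [partialSum, ← Finset.sum_add_distrib, Finset.smul_sum]
  refine Finset.sum_congr rfl fun i _ ↦ ?_
  by_cases h : (i : ℕ) < k <;> simp [flipFrom, h, two_smul]

lemma lt_partialSum_or_flipFrom (N : Seminorm ℝ E) {n k : ℕ} {a : ℝ} {x : Fin n → E}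
    (h : a < N (partialSum k x)) :
    a < N (partialSum n x) ∨ a < N (partialSum n (flipFrom k x)) := by
  by_contra! hc
  have h1 : N ((2 : ℝ) • partialSum k x) ≤ 2 * a := by
    rw [← partialSum_flipFrom]
    linarith [map_add_le_add N (partialSum n (flipFrom k x)) (partialSum n x)]
  rw [map_smul_eq_mul] at h1
  norm_num at h1
  linarith

variable [MeasurableSpace E] [BorelSpace E]

/-- **Lévy's maximal inequality** for independent symmetric random variables. -/
theorem levy_maximal_pi [SecondCountableTopology E] {n : ℕ} (μ : Fin n → Measure E)
    [∀ i, IsProbabilityMeasure (μ i)] [∀ i, (μ i).IsNegInvariant]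
    (N : Seminorm ℝ E) (hN : Continuous N) (a : ℝ) :
    Measure.pi μ {x | ∃ k ≤ n, a < N (partialSum k x)} ≤
      2 * Measure.pi μ {x | a < N (partialSum n x)} := by
  set ν := Measure.pi μ
  set G : Set (Fin n → E) := {x | a < N (partialSum n x)}
  set M : ℕ → Set (Fin n → E) := fun k ↦ {x | a < N (partialSum k x)}
  have hM : ∀ k, MeasurableSet (M k) := fun k ↦
    measurableSet_lt measurable_const (hN.measurable.comp (measurable_partialSum k))
  have hG : MeasurableSet G := hM n
  have hA : ∀ k, MeasurableSet (disjointed M k) := fun k ↦ MeasurableSet.disjointed hM k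
  -- First passage at `k` is decided by the first `k` coordinates, which the flip leaves alone.
  have hflip : ∀ k, flipFrom k ⁻¹' disjointed M k = disjointed M k := by
    intro k
    ext x
    simp only [Set.mem_preimage, disjointed_eq_inter_compl, Set.mem_inter_iff, Set.mem_iInter,
      Set.mem_compl_iff, M, Set.mem_ofPred_eq, partialSum_flipFrom_of_le le_rfl]
    refine and_congr_right fun _ ↦ forall₂_congr fun j hj ↦ ?_
    rw [partialSum_flipFrom_of_le hj.le]
  have hhalf : ∀ k, ν (disjointed M k) ≤ 2 * ν (disjointed M k ∩ G) := by
    intro k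
    have hsub : disjointed M k ⊆
        (disjointed M k ∩ G) ∪ flipFrom k ⁻¹' (disjointed M k ∩ G) := by
      intro x hx
      have hx' : x ∈ flipFrom k ⁻¹' disjointed M k := by rwa [hflip]
      rcases lt_partialSum_or_flipFrom N (disjointed_subset M k hx : x ∈ M k) with h | h
      · exact Or.inl ⟨hx, h⟩
      · exact Or.inr ⟨hx', h⟩
    calc ν (disjointed M k) ≤ _ := measure_mono hsub
      _ ≤ _ := measure_union_le _ _
      _ = 2 * ν (disjointed M k ∩ G) := by
        rw [(measurePreserving_flipFrom k μ).measure_preimage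
          ((hA k).inter hG).nullMeasurableSet, two_mul]
  have hdisj := disjoint_disjointed M
  calc ν {x | ∃ k ≤ n, a < N (partialSum k x)}
      ≤ ν (⋃ k, disjointed M k) := by
        rw [iUnion_disjointed]
        -- Indices beyond `n` add nothing: there `partialSum k` is already the full sum.
        refine measure_mono fun x hx ↦ ?_
        obtain ⟨k, -, hk⟩ := hx
        exact Set.mem_iUnion.2 ⟨k, hk⟩
    _ ≤ ∑' k, ν (disjointed M k) := measure_iUnion_le _
    _ ≤ ∑' k, 2 * ν (disjointed M k ∩ G) := ENNReal.tsum_le_tsum hhalf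
    _ = 2 * ν (⋃ k, disjointed M k ∩ G) := by
        rw [ENNReal.tsum_mul_left, measure_iUnion _ fun k ↦ (hA k).inter hG]
        exact fun i j hij ↦ (hdisj hij).mono Set.inter_subset_left Set.inter_subset_left
    _ ≤ 2 * ν G := by
        gcongr
        exact Set.iUnion_subset fun k ↦ Set.inter_subset_right

end Levy

lemma partialSum_sub {E : Type*} [NormedAddCommGroup E] {n k : ℕ} (hk : k ≤ n) (f : ℕ → E) :
    partialSum k (fun i : Fin n ↦ f (i + 1) - f i) = f k - f 0 := by
  rw [partialSum, Fin.sum_univ_eq_sum_range (fun i ↦ if i < k then f (i + 1) - f i else 0) n,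
    ← Finset.sum_range_sub f k, ← Finset.sum_filter]
  congr 1
  grind

theorem levy_maximal_increments {Ω E : Type*} [MeasurableSpace Ω] (P : Measure Ω)
    [IsProbabilityMeasure P] [NormedAddCommGroup E] [NormedSpace ℝ E]
    [SecondCountableTopology E] [MeasurableSpace E] [BorelSpace E] (Y : ℕ → Ω → E)
    (hind : iIndepFun (fun i ω ↦ Y (i + 1) ω - Y i ω) P)
    (hmeas : ∀ i, AEMeasurable (fun ω ↦ Y (i + 1) ω - Y i ω) P)
    (hsymm : ∀ i, (P.map (fun ω ↦ Y (i + 1) ω - Y i ω)).IsNegInvariant)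
    (N : Seminorm ℝ E) (hN : Continuous N) (a : ℝ) (n : ℕ) :
    P {ω | ∃ k ≤ n, a < N (Y k ω - Y 0 ω)} ≤ 2 * P {ω | a < N (Y n ω - Y 0 ω)} := by
  have hmeas' : AEMeasurable (fun ω (i : Fin n) ↦ Y (i + 1) ω - Y i ω) P :=
    aemeasurable_pi_lambda _ fun i ↦ hmeas i
  have hlaw : P.map (fun ω (i : Fin n) ↦ Y (i + 1) ω - Y i ω) =
      Measure.pi fun i : Fin n ↦ P.map (fun ω ↦ Y (i + 1) ω - Y i ω) :=
    (iIndepFun_iff_map_fun_eq_pi_map fun i : Fin n ↦ hmeas i).1 (hind.precomp Fin.val_injective)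
  have : ∀ i : Fin n, IsProbabilityMeasure (P.map (fun ω ↦ Y (i + 1) ω - Y i ω)) :=
    fun i ↦ Measure.isProbabilityMeasure_map (hmeas i)
  have hM : ∀ k, MeasurableSet {x : Fin n → E | a < N (partialSum k x)} := fun k ↦
    measurableSet_lt measurable_const (hN.measurable.comp (measurable_partialSum k))
  have hmax : MeasurableSet {x : Fin n → E | ∃ k ≤ n, a < N (partialSum k x)} := by
    have : {x : Fin n → E | ∃ k ≤ n, a < N (partialSum k x)} =
        ⋃ k, ⋃ (_ : k ≤ n), {x : Fin n → E | a < N (partialSum k x)} := by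
      ext x; simp
    rw [this]
    exact MeasurableSet.iUnion fun k ↦ MeasurableSet.iUnion fun _ ↦ hM k
  have key := levy_maximal_pi (fun i : Fin n ↦ P.map (fun ω ↦ Y (i + 1) ω - Y i ω)) N hN a
  rw [← hlaw, Measure.map_apply_of_aemeasurable hmeas' hmax,
    Measure.map_apply_of_aemeasurable hmeas' (hM n)] at key
  convert! key using 3
  · ext ω
    refine exists_congr fun k ↦ and_congr_right fun hk ↦ ?_
    rw [partialSum_sub hk fun i ↦ Y i ω]
  · ext ω
    simp only [Set.mem_ofPred_eq, Set.mem_preimage, partialSum_sub le_rfl fun i ↦ Y i ω]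

/-- Rounding `t / T` down to a multiple of `2⁻ⁿ` gives grid points converging to `t`. -/
lemma exists_dyadic_mem_of_isOpen {T t : ℝ≥0} (ht : t ≤ T) (hT : 0 < T) {U : Set ℝ≥0}
    (hU : IsOpen U) (htU : t ∈ U) : ∃ n k : ℕ, k ≤ 2 ^ n ∧ (k : ℝ≥0) * (T / 2 ^ n) ∈ U := by
  have h1 : Filter.Tendsto (fun n : ℕ ↦ (⌊(t / T : ℝ) * 2 ^ n⌋₊ : ℝ) / 2 ^ n) Filter.atTop
      (nhds (t / T : ℝ)) :=
    (tendsto_nat_floor_mul_div_atTop (by positivity)).comp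
      (tendsto_pow_atTop_atTop_of_one_lt one_lt_two)
  have h2 : Filter.Tendsto
      (fun n : ℕ ↦ ((⌊(t / T : ℝ) * 2 ^ n⌋₊ : ℕ) : ℝ≥0) * (T / 2 ^ n)) Filter.atTop (nhds t) := by
    rw [← NNReal.tendsto_coe]
    have hT' : (T : ℝ) ≠ 0 := by exact_mod_cast hT.ne'
    convert! h1.mul_const (T : ℝ) using 2
    · push_cast; ring
    · field_simp
  obtain ⟨n, hn⟩ := (h2.eventually (hU.mem_nhds htU)).exists
  refine ⟨n, _, ?_, hn⟩
  have h3 : (t / T : ℝ) * 2 ^ n ≤ ((2 ^ n : ℕ) : ℝ) := by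
    push_cast
    refine mul_le_of_le_one_left (by positivity) (div_le_one_of_le₀ ?_ T.2)
    exact_mod_cast ht
  exact Nat.floor_le_of_le h3

namespace IsContinuousBrownianMotion

variable {Ω E : Type*} [MeasurableSpace Ω] {P : Measure Ω}
  [NormedAddCommGroup E] [NormedSpace ℝ E] [MeasurableSpace E] {B : ℝ≥0 → Ω → E}

lemma aemeasurable_sub (hB : IsContinuousBrownianMotion B P) {s t : ℝ≥0} (hst : s ≤ t) :
    AEMeasurable (fun ω ↦ B t ω - B s ω) P := by
  obtain ⟨μ, -, -, hlaw⟩ := hB.gaussian_increments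
  exact (hlaw s t hst).aemeasurable

lemma aemeasurable (hB : IsContinuousBrownianMotion B P) (t : ℝ≥0) : AEMeasurable (B t) P := by
  refine (hB.aemeasurable_sub (zero_le (a := t))).congr ?_
  filter_upwards [hB.start_zero] with ω h0
  rw [h0, sub_zero]

variable [CompleteSpace E] [SecondCountableTopology E] [BorelSpace E]

lemma isNegInvariant_map_sub (hB : IsContinuousBrownianMotion B P) {s t : ℝ≥0} (hst : s ≤ t) :
    (P.map fun ω ↦ B t ω - B s ω).IsNegInvariant := by
  obtain ⟨μ, hμ, h0, hlaw⟩ := hB.gaussian_increments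
  have := IsGaussian.isNegInvariant_of_centered μ h0
  rw [(hlaw s t hst).map_eq]
  exact isNegInvariant_map_smul μ _

variable [IsProbabilityMeasure P]

lemma measure_exists_grid_le (hB : IsContinuousBrownianMotion B P) (N : Seminorm ℝ E)
    (hN : Continuous N) (a : ℝ) (δ : ℝ≥0) (n : ℕ) :
    P {ω | ∃ k ≤ n, a < N (B (k * δ) ω - B 0 ω)} ≤ 2 * P {ω | a < N (B (n * δ) ω - B 0 ω)} := by
  have hmono : Monotone fun k : ℕ ↦ (k : ℝ≥0) * δ := fun i j hij ↦ by dsimp only; gcongr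
  simpa using levy_maximal_increments P (fun k ↦ B (k * δ)) (hB.indep_increments.nat hmono)
    (fun i ↦ hB.aemeasurable_sub (hmono i.le_succ))
    (fun i ↦ hB.isNegInvariant_map_sub (hmono i.le_succ)) N hN a n

lemma measure_exists_lt_le (hB : IsContinuousBrownianMotion B P) (N : Seminorm ℝ E)
    (hN : Continuous N) (a : ℝ) {T : ℝ≥0} (hT : 0 < T) :
    P {ω | ∃ t ≤ T, a < N (B t ω)} ≤ 2 * P {ω | a < N (B T ω)} := by
  set D : ℕ → Set Ω := fun n ↦ {ω | ∃ k : ℕ, k ≤ 2 ^ n ∧ a < N (B (k * (T / 2 ^ n)) ω - B 0 ω)}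
  have hDmono : Monotone D := by
    refine monotone_nat_of_le_succ fun n ω ↦ ?_
    rintro ⟨k, hk, h⟩
    refine ⟨2 * k, by rw [pow_succ]; omega, ?_⟩
    have hgrid : ((2 * k : ℕ) : ℝ≥0) * (T / 2 ^ (n + 1)) = k * (T / 2 ^ n) := by
      push_cast
      rw [pow_succ]
      field_simp
    rwa [hgrid]
  calc P {ω | ∃ t ≤ T, a < N (B t ω)} ≤ P (⋃ n, D n) := by
        refine measure_mono_ae ?_
        filter_upwards [hB.start_zero, hB.continuous_paths] with ω h0 hc
        rintro ⟨t, ht, hat⟩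
        -- The strict inequality makes the set of exceedance times open, so it meets some grid.
        obtain ⟨n, k, hk, hU⟩ := exists_dyadic_mem_of_isOpen ht hT
          (isOpen_lt continuous_const (hN.comp hc)) hat
        exact Set.mem_iUnion.2 ⟨n, k, hk, by simpa [h0] using hU⟩
    _ = ⨆ n, P (D n) := hDmono.measure_iUnion
    _ ≤ 2 * P {ω | a < N (B T ω)} := by
        refine iSup_le fun n ↦ (hB.measure_exists_grid_le N hN a _ _).trans_eq ?_
        have hTn : ((2 ^ n : ℕ) : ℝ≥0) * (T / 2 ^ n) = T := by push_cast; field_simp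
        rw [hTn]
        congr 1
        refine measure_congr ?_
        filter_upwards [hB.start_zero] with ω h0
        refine propext (Iff.of_eq ?_)
        change (a < N (B T ω - B 0 ω)) = (a < N (B T ω))
        rw [h0, sub_zero]

end IsContinuousBrownianMotion

/-- The strict events decrease to the closed one, so continuity from above applies. -/
lemma tendsto_measure_lt_of_le {Ω : Type*} [MeasurableSpace Ω] {P : Measure Ω}
    [IsFiniteMeasure P] {f : Ω → ℝ} (hf : AEMeasurable f P) {u : ℕ → ℝ} {c : ℝ}
    (hu : StrictMono u) (huc : Filter.Tendsto u Filter.atTop (nhds c)) :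
    Filter.Tendsto (fun n ↦ P {ω | u n < f ω}) Filter.atTop (nhds (P {ω | c ≤ f ω})) := by
  have hset : {ω | c ≤ f ω} = ⋂ n, {ω | u n < f ω} := by
    ext ω
    simp only [Set.mem_ofPred_eq, Set.mem_iInter]
    exact ⟨fun h n ↦ ((hu n.lt_succ_self).trans_le (hu.monotone.ge_of_tendsto huc _)).trans_le h,
      fun h ↦ le_of_tendsto' huc fun n ↦ (h n).le⟩
  rw [hset]
  refine tendsto_measure_iInter_atTop (fun n ↦ nullMeasurableSet_lt aemeasurable_const hf)
    (fun i j hij ω h ↦ (hu.monotone hij).trans_lt h) ⟨0, measure_ne_top _ _⟩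

theorem lemma3p4 {Ω E : Type*} [MeasurableSpace Ω] (P : Measure Ω) [IsProbabilityMeasure P]
    [NormedAddCommGroup E] [NormedSpace ℝ E] [CompleteSpace E] [TopologicalSpace.SeparableSpace E]
    [MeasurableSpace E] [BorelSpace E]
    (B : ℝ≥0 → Ω → E) (hB : IsContinuousBrownianMotion B P)
    (N : Seminorm ℝ E) (hN : Continuous N)
    (T : ℝ≥0) (hT : 0 < T) (lam : ℝ) (hlam : 0 < lam) :
    P {ω | lam ≤ ⨆ t : Set.Icc (0 : ℝ≥0) T, N (B t ω)} ≤ 2 * P {ω | lam ≤ N (B T ω)} := by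
  have : SecondCountableTopology E := UniformSpace.secondCountable_of_separable E
  obtain ⟨u, hu, hul, huc⟩ := exists_seq_strictMono_tendsto lam
  refine ge_of_tendsto' (ENNReal.Tendsto.const_mul (tendsto_measure_lt_of_le
    (hN.measurable.comp_aemeasurable (hB.aemeasurable T)) hu huc) (Or.inr (by simp))) fun n ↦ ?_
  refine (measure_mono fun ω hω ↦ ?_).trans (hB.measure_exists_lt_le N hN (u n) hT)
  have : Nonempty (Set.Icc (0 : ℝ≥0) T) := ⟨⟨0, le_rfl, hT.le⟩⟩
  -- The supremum may not be attained, hence the drop to `u n < lam`. No boundedness is needed: if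
  -- all values were at most `u n`, so would be the supremum.
  obtain ⟨t, ht⟩ := exists_lt_of_lt_ciSup ((hul n).trans_le hω)
  exact ⟨t, t.2.2, ht⟩
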